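/- Let $\mathfrak H$ be a complex Hilbert space and let $L$ be a positive self-adjoint operator in $\mathfrak H$ (self-adjoint, possibly unbounded, with $(Lu,u)>0$ for $0\ne u\in\mathcal D(L)$). Let $\mathfrak H_L$ be the completion of $\mathcal D(L)$ in the norm $\|u\|_L^2=(Lu,u)$, let $H=\mathfrak H_L\oplus\mathfrak H$ be the energy space, and let $W(t)$, $t\in\mathbb R$, be the group of solutions of the Cauchy problem for $u_{tt}=-Lu$, i.e. the strongly continuous one-parameter group of unitary operators in $H$ whose generator is the closure of the operator $\begin{bmatrix}u\\ v\end{bmatrix}\mapsto\begin{bmatrix}v\\ -Lu\end{bmatrix}$, $u,v\in\mathcal D(L)$. Subspaces $D,D'$ of $H$ are called asymptotically equivalent if $D\subset\bigvee_{t\in\mathbb R}W(t)D'$ and $D'\subset\bigvee_{t\in\mathbb R}W(t)D$, where $\bigvee$ denotes the closed linear span. Let $B$ be a simple maximal symmetric operator acting in a (closed) subspace $\mathfrak H_0$ of $\mathfrak H$, with zero defect number in $\mathbb C_+$; that is, $B$ is densely defined in $\mathfrak H_0$, closed and symmetric, $\ker(B^*-iI)=\{0\}$, and the part of $B$ in any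 nonzero reducing subspace is not self-adjoint. Assume that $L$ is an extension of $B^2$. Let $V$ be an isometric operator in $\mathfrak H_0$ that commutes with $B$: $V\mathcal D(B)\subset\mathcal D(B)$ and $VBu=BVu$ for all $u\in\mathcal D(B)$. Let $B_V=VBV^*$ be the operator in $\mathfrak H_0^V=V\mathfrak H_0$ with domain $V\mathcal D(B)$. Let $D_\pm$ be the closures in $H$ of the sets $\left\{\begin{bmatrix}u\\ \pm iBu\end{bmatrix}: u\in\mathcal D(B^2)\right\}$, and let $D_\pm^V$ be defined in the same way with $B_V$ in place of $B$. Let $T=(B-iI)(B+iI)^{-1}$ be the Cayley transform of $B$ and let $P_{\ker V^*}$ be the orthogonal projection in $\mathfrak H_0$ onto $\ker V^*=\mathfrak H_0\ominus\mathfrak H_0^V$. Then the subspaces $D_\pm$ and $D_\pm^V$ are asymptotically equivalent if and only if $$\lim_{n\to\infty}\|(P_{\ker V^*}T)^n\gamma\|=0\qquad\text{for all }\gamma\in\ker V^*.$$ That is, the condition is necessary and sufficient for the asymptotic equivalence of $D_+$ and $D_+^V$, and likewise for that of $D_-$ and $D_-^V$. -/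

import Mathlib

open Complex Filter Topology
open scoped InnerProductSpace

namespace AbstractWave

/-! ### The energy space and the group of solutions of `u'' = -L u` -/

/-- A positive self-adjoint (in general unbounded) operator in a Hilbert space: `L = L†` and
`(L u, u) > 0` for all nonzero `u` in the domain. -/
structure PositiveSelfAdjoint (E : Type*) [NormedAddCommGroup E] [InnerProductSpace ℂ E]
    [CompleteSpace E] where
  op : E →ₗ.[ℂ] E
  isSelfAdjoint : IsSelfAdjoint op
  pos : ∀ u : op.domain, u ≠ 0 → 0 < (⟪(u : E), op u⟫_ℂ).re

section Energy

variable {E : Type*} [NormedAddCommGroup E] [InnerProductSpace ℂ E] [CompleteSpace E]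

theorem PositiveSelfAdjoint.symm (L : PositiveSelfAdjoint E) (u v : L.op.domain) :
    ⟪L.op u, (v : E)⟫_ℂ = ⟪(u : E), L.op v⟫_ℂ := by
  have h := LinearPMap.adjoint_isFormalAdjoint (L.isSelfAdjoint.dense_domain)
  rw [LinearPMap.isSelfAdjoint_def.mp L.isSelfAdjoint] at h
  exact h u v

/-- The domain of `L`, to be normed by `‖u‖_L² = (L u, u)` (not by the norm of `E`). -/
def FormDomain (L : PositiveSelfAdjoint E) : Type _ := L.op.domain

noncomputable instance (L : PositiveSelfAdjoint E) : AddCommGroup (FormDomain L) :=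
  inferInstanceAs (AddCommGroup L.op.domain)

noncomputable instance (L : PositiveSelfAdjoint E) : Module ℂ (FormDomain L) :=
  inferInstanceAs (Module ℂ L.op.domain)

/-- The inner product `(L u, v)` on the domain of `L`. -/
@[reducible] noncomputable def formCore (L : PositiveSelfAdjoint E) :
    InnerProductSpace.Core ℂ (FormDomain L) where
  inner u v := ⟪((show L.op.domain from u : L.op.domain) : E), L.op (show L.op.domain from v)⟫_ℂ
  conj_inner_symm u v := by
    rw [inner_conj_symm]
    exact L.symm u v
  re_inner_nonneg u := by
    by_cases hu : (show L.op.domain from u) = 0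
    · change 0 ≤ (⟪((show L.op.domain from u : L.op.domain) : E), _⟫_ℂ).re
      rw [hu]; simp
    · exact (L.pos u hu).le
  add_left u v w := inner_add_left (𝕜 := ℂ) _ _ _
  smul_left u v r := inner_smul_left (𝕜 := ℂ) _ _ _
  definite u h := by
    by_contra hu
    have h1 := L.pos u hu
    have h2 : (⟪((show L.op.domain from u : L.op.domain) : E),
      L.op (show L.op.domain from u)⟫_ℂ) = 0 := h
    rw [h2] at h1
    simp at h1

noncomputable instance (L : PositiveSelfAdjoint E) : NormedAddCommGroup (FormDomain L) :=
  (formCore L).toNormedAddCommGroup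

noncomputable instance (L : PositiveSelfAdjoint E) : InnerProductSpace ℂ (FormDomain L) :=
  InnerProductSpace.ofCore (formCore L).toCore

/-- The space `𝔥_L`: completion of the domain of `L` in the norm `‖·‖_L`. -/
abbrev FormSpace (L : PositiveSelfAdjoint E) : Type _ := UniformSpace.Completion (FormDomain L)

/-- The energy space `𝔥_L ⊕ 𝔥`. -/
abbrev EnergySpace (L : PositiveSelfAdjoint E) : Type _ := WithLp 2 (FormSpace L × E)

/-- The element `[u; v]` of the energy space, where `u` lies in the domain of `L`. -/
noncomputable def state (L : PositiveSelfAdjoint E) (u : L.op.domain) (v : E) : EnergySpace L :=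
  WithLp.toLp 2 (((show FormDomain L from u : FormDomain L) : FormSpace L), v)

theorem state_add (L : PositiveSelfAdjoint E) (u u' : L.op.domain) (v v' : E) :
    state L (u + u') (v + v') = state L u v + state L u' v' := by
  unfold state
  rw [← WithLp.toLp_add, Prod.mk_add_mk, ← UniformSpace.Completion.coe_add]
  rfl

theorem state_smul (L : PositiveSelfAdjoint E) (c : ℂ) (u : L.op.domain) (v : E) :
    state L (c • u) (c • v) = c • state L u v := by
  unfold state
  rw [← WithLp.toLp_smul, Prod.smul_mk, ← UniformSpace.Completion.coe_smul]
  rfl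

/-- `W` is the group of solutions of the Cauchy problem for `u'' = -L u`: the strongly continuous
one-parameter group of unitary operators in the energy space whose generator is the closure of the
operator `[u; v] ↦ [v; -L u]` with domain `D(L) × D(L)`. -/
structure IsWaveGroup (L : PositiveSelfAdjoint E)
    (W : ℝ → EnergySpace L ≃ₗᵢ[ℂ] EnergySpace L) : Prop where
  map_zero : ∀ x, W 0 x = x
  map_add : ∀ s t x, W (s + t) x = W s (W t x)
  continuous : ∀ x, Continuous fun t => W t x
  generator : ∀ x y : EnergySpace L, HasDerivAt (fun t : ℝ => W t x) y 0 ↔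
    (x, y) ∈ closure {p : EnergySpace L × EnergySpace L | ∃ u v : L.op.domain,
      p = (state L u (v : E), state L v (-L.op u))}

/-- Asymptotic equivalence with respect to `W`: each of the two subspaces lies in the closed
linear span of the orbit of the other one. -/
def AsymptoticallyEquivalent {H : Type*} [NormedAddCommGroup H] [InnerProductSpace ℂ H]
    (W : ℝ → H ≃ₗᵢ[ℂ] H) (D D' : Submodule ℂ H) : Prop :=
  D ≤ (⨆ t : ℝ, D'.map ((W t).toLinearEquiv : H →ₗ[ℂ] H)).topologicalClosure ∧
  D' ≤ (⨆ t : ℝ, D.map ((W t).toLinearEquiv : H →ₗ[ℂ] H)).topologicalClosure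

variable {F : Type*} [NormedAddCommGroup F] [InnerProductSpace ℂ F]

/-- For an operator `B` in a Hilbert space `F` that is embedded in `E` by `j`: the linear
manifold of the vectors `[u; c B u]` of the energy space, `u ∈ D(B²)`. -/
noncomputable def squareGraph (L : PositiveSelfAdjoint E) (j : F →ₗᵢ[ℂ] E) (B : F →ₗ.[ℂ] F)
    (c : ℂ) : Submodule ℂ (EnergySpace L) where
  carrier := {x | ∃ (u : B.domain) (_ : B u ∈ B.domain) (hL : j u ∈ L.op.domain),
    x = state L ⟨j u, hL⟩ (c • j (B u))}
  zero_mem' := by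
    refine ⟨0, by simp, by simp, ?_⟩
    have h := state_smul L 0 0 0
    rw [zero_smul, zero_smul, zero_smul] at h
    rw [← h]
    congr 1
    · ext; simp
    · simp
  add_mem' := by
    rintro _ _ ⟨u, hu, hL, rfl⟩ ⟨u', hu', hL', rfl⟩
    refine ⟨u + u', ?_, ?_, ?_⟩
    · rw [LinearPMap.map_add]; exact add_mem hu hu'
    · rw [Submodule.coe_add, _root_.map_add]; exact add_mem hL hL'
    · rw [← state_add]
      congr 1
      · ext; simp
      · rw [LinearPMap.map_add, _root_.map_add, smul_add]
  smul_mem' := by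
    rintro a _ ⟨u, hu, hL, rfl⟩
    refine ⟨a • u, ?_, ?_, ?_⟩
    · rw [LinearPMap.map_smul]; exact Submodule.smul_mem _ _ hu
    · rw [Submodule.coe_smul, _root_.map_smul]; exact Submodule.smul_mem _ _ hL
    · rw [← state_smul]
      congr 1
      · ext; simp
      · rw [LinearPMap.map_smul, _root_.map_smul, smul_comm]

/-- `D₊`: closure in the energy space of `{[u; iBu] : u ∈ D(B²)}`. -/
noncomputable def outgoing (L : PositiveSelfAdjoint E) (j : F →ₗᵢ[ℂ] E) (B : F →ₗ.[ℂ] F) :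
    Submodule ℂ (EnergySpace L) :=
  (squareGraph L j B I).topologicalClosure

/-- `D₋`: closure in the energy space of `{[u; -iBu] : u ∈ D(B²)}`. -/
noncomputable def incoming (L : PositiveSelfAdjoint E) (j : F →ₗᵢ[ℂ] E) (B : F →ₗ.[ℂ] F) :
    Submodule ℂ (EnergySpace L) :=
  (squareGraph L j B (-I)).topologicalClosure

/-- `L` is an extension of `B²` (with exit to the larger space `E`). -/
def ExtendsSquare (L : PositiveSelfAdjoint E) (j : F →ₗᵢ[ℂ] E) (B : F →ₗ.[ℂ] F) : Prop :=
  ∀ (u : B.domain) (hu : B u ∈ B.domain),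
    ∃ hL : j u ∈ L.op.domain, L.op ⟨j u, hL⟩ = j (B ⟨B u, hu⟩)

end Energy

/-! ### Simple maximal symmetric operators -/

section Symmetric

variable {F : Type*} [NormedAddCommGroup F] [InnerProductSpace ℂ F] [CompleteSpace F]

/-- The part of `B` in a closed subspace `M`: the operator in `M` with domain `D(B) ∩ M`
given by `u ↦ P_M B u`, which is just `u ↦ B u` when `M` reduces `B`. -/
noncomputable def partIn (B : F →ₗ.[ℂ] F) (M : Submodule ℂ F) [CompleteSpace M] :
    M →ₗ.[ℂ] M where
  domain := B.domain.comap M.subtype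
  toFun := (M.orthogonalProjectionOnto : F →ₗ[ℂ] M) ∘ₗ B.toFun ∘ₗ
    (M.subtype.restrict (p := B.domain.comap M.subtype) (q := B.domain) fun _ h => h)

/-- The closed subspace `M` reduces `B`: `P_M B ⊆ B P_M`. -/
def Reduces (B : F →ₗ.[ℂ] F) (M : Submodule ℂ F) [CompleteSpace M] : Prop :=
  ∀ u : B.domain, ∃ h : M.starProjection (u : F) ∈ B.domain,
    B ⟨M.starProjection (u : F), h⟩ = M.starProjection (B u)

/-- `B` is simple: its part in a nonzero reducing subspace is never self-adjoint. -/
def IsSimple (B : F →ₗ.[ℂ] F) : Prop :=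
  ∀ (M : Submodule ℂ F) [CompleteSpace M], M ≠ ⊥ → Reduces B M → ¬ IsSelfAdjoint (partIn B M)

/-- `B` is a simple maximal symmetric operator whose defect number in the upper half-plane
vanishes: densely defined, closed, symmetric, simple, and `ker (B† - i) = 0`. -/
structure IsSimpleMaximalSymmetric (B : F →ₗ.[ℂ] F) : Prop where
  dense : Dense (B.domain : Set F)
  closed : B.IsClosed
  symm : ∀ u v : B.domain, ⟪B u, (v : F)⟫_ℂ = ⟪(u : F), B v⟫_ℂ
  defect : ∀ y : B.adjoint.domain, B.adjoint y = I • (y : F) → y = 0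
  simple : IsSimple B

/-- The map `B + c : D(B) → F`. -/
noncomputable def shiftBy (B : F →ₗ.[ℂ] F) (c : ℂ) : B.domain →ₗ[ℂ] F :=
  B.toFun + c • B.domain.subtype

theorem norm_shiftBy_sq {B : F →ₗ.[ℂ] F} (hB : IsSimpleMaximalSymmetric B) (u : B.domain) :
    ‖shiftBy B I u‖ ^ 2 = ‖B u‖ ^ 2 + ‖(u : F)‖ ^ 2 := by
  have h1 : shiftBy B I u = B u + I • (u : F) := rfl
  rw [h1, @norm_add_sq ℂ, norm_smul, Complex.norm_I, one_mul, inner_smul_right]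
  have h2 : (starRingEnd ℂ) ⟪B u, (u : F)⟫_ℂ = ⟪B u, (u : F)⟫_ℂ := by
    rw [inner_conj_symm]; exact (hB.symm u u).symm
  have h3 : (⟪B u, (u : F)⟫_ℂ).im = 0 := Complex.conj_eq_iff_im.mp h2
  simp [h3]

/-- For a closed symmetric operator `B` with `ker (B† - i) = 0`, the map `B + i : D(B) → F`
is a bijection. -/
theorem shiftBy_bijective {B : F →ₗ.[ℂ] F} (hB : IsSimpleMaximalSymmetric B) :
    Function.Bijective (shiftBy B I) := by
  have hnorm := norm_shiftBy_sq hB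
  constructor
  · rw [injective_iff_map_eq_zero]
    intro u hu
    have := hnorm u
    rw [hu] at this
    have h0 : ‖(u : F)‖ = 0 := by
      rw [norm_zero] at this
      nlinarith [sq_nonneg ‖B u‖, sq_nonneg ‖(u : F)‖]
    exact Subtype.ext (norm_eq_zero.mp h0)
  · have hclosed : IsClosed ((shiftBy B I).range : Set F) := by
      rw [← isSeqClosed_iff_isClosed]
      intro x y hx hy
      choose u hu using hx
      have hc : CauchySeq x := hy.cauchySeq
      have hcu : CauchySeq fun n => ((u n : F), B (u n)) := by
        rw [Metric.cauchySeq_iff] at hc ⊢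
        intro ε hε
        obtain ⟨N, hN⟩ := hc ε hε
        refine ⟨N, fun m hm n hn => ?_⟩
        have h := hN m hm n hn
        rw [dist_eq_norm, ← hu m, ← hu n, ← map_sub] at h
        have hs := hnorm (u m - u n)
        rw [Prod.dist_eq, dist_eq_norm, dist_eq_norm, ← LinearPMap.map_sub]
        rw [Submodule.coe_sub] at hs
        apply max_lt
        · refine lt_of_le_of_lt ?_ h
          apply le_of_sq_le_sq _ (norm_nonneg _)
          rw [hs]; nlinarith [sq_nonneg ‖B (u m - u n)‖]
        · refine lt_of_le_of_lt ?_ h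
          apply le_of_sq_le_sq _ (norm_nonneg _)
          rw [hs]; nlinarith [sq_nonneg ‖(u m : F) - u n‖]
      obtain ⟨p, hp⟩ := cauchySeq_tendsto_of_complete hcu
      have hpg : p ∈ (B.graph : Set (F × F)) :=
        hB.closed.mem_of_tendsto hp (Eventually.of_forall fun n => B.mem_graph (u n))
      obtain ⟨w, hw1, hw2⟩ := (LinearPMap.mem_graph_iff B).mp hpg
      refine ⟨w, ?_⟩
      have h1 : Tendsto x atTop (𝓝 (p.2 + I • p.1)) := by
        have : x = fun n => B (u n) + I • (u n : F) := funext fun n => (hu n).symm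
        rw [this]
        exact ((continuous_snd.tendsto p).comp hp).add
          (((continuous_fst.tendsto p).comp hp).const_smul I)
      rw [tendsto_nhds_unique hy h1, ← hw1, ← hw2]
      rfl
    have hcompl : (shiftBy B I).rangeᗮ = ⊥ := by
      rw [eq_bot_iff]
      intro y hy
      have h1 : ∀ u : B.domain, ⟪I • y, (u : F)⟫_ℂ = ⟪y, B u⟫_ℂ := by
        intro u
        have h2 : ⟪y, B u + I • (u : F)⟫_ℂ = 0 := by
          rw [← inner_conj_symm, hy (B u + I • (u : F)) ⟨u, rfl⟩, map_zero]
        rw [inner_add_right, inner_smul_right] at h2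
        rw [inner_smul_left, Complex.conj_I]
        linear_combination -h2
      have hd : y ∈ B.adjoint.domain := LinearPMap.mem_adjoint_domain_of_exists y ⟨_, h1⟩
      have h3 := hB.defect ⟨y, hd⟩ (LinearPMap.adjoint_apply_eq hB.dense ⟨y, hd⟩ h1)
      simpa using congrArg Subtype.val h3
    have : (shiftBy B I).range = ⊤ := by
      have : CompleteSpace (shiftBy B I).range := hclosed.completeSpace_coe
      rwa [Submodule.orthogonal_eq_bot_iff] at hcompl
    exact LinearMap.range_eq_top.mp this

/-- The Cayley transform `T = (B - i)(B + i)⁻¹`. -/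
noncomputable def cayley (B : F →ₗ.[ℂ] F) (hB : IsSimpleMaximalSymmetric B) : F →ₗ[ℂ] F :=
  shiftBy B (-I) ∘ₗ (LinearEquiv.ofBijective (shiftBy B I) (shiftBy_bijective hB)).symm.toLinearMap

/-- The isometry `V` commutes with `B`: `V D(B) ⊆ D(B)` and `V B u = B V u` on `D(B)`. -/
def CommutesWith (V : F →ₗᵢ[ℂ] F) (B : F →ₗ.[ℂ] F) : Prop :=
  ∀ u : B.domain, ∃ h : V u ∈ B.domain, B ⟨V u, h⟩ = V (B u)

/-- The operator `B_V = V B V⁻¹` in the space `V F`, with domain `V D(B)`. -/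
noncomputable def transported (V : F →ₗᵢ[ℂ] F) (B : F →ₗ.[ℂ] F) :
    V.toLinearMap.range →ₗ.[ℂ] V.toLinearMap.range where
  domain := B.domain.comap V.equivRange.symm.toLinearEquiv.toLinearMap
  toFun := V.equivRange.toLinearEquiv.toLinearMap ∘ₗ B.toFun ∘ₗ
    (V.equivRange.symm.toLinearEquiv.toLinearMap.restrict
      (p := B.domain.comap V.equivRange.symm.toLinearEquiv.toLinearMap) (q := B.domain)
      fun _ h => h)

/-- The subspace `ker V†`, i.e. the orthogonal complement of `V F`. -/
noncomputable def kerAdjoint (V : F →ₗᵢ[ℂ] F) : Submodule ℂ F :=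
  (ContinuousLinearMap.adjoint V.toContinuousLinearMap).ker

noncomputable instance (V : F →ₗᵢ[ℂ] F) : CompleteSpace (kerAdjoint V) :=
  (ContinuousLinearMap.isClosed_ker
    (ContinuousLinearMap.adjoint V.toContinuousLinearMap)).completeSpace_coe

/-- The operator `P T`, where `P` is the orthogonal projection onto `ker V†` and `T` is the Cayley
transform of `B`. -/
noncomputable def compressedCayley (B : F →ₗ.[ℂ] F) (hB : IsSimpleMaximalSymmetric B)
    (V : F →ₗᵢ[ℂ] F) : Module.End ℂ F :=
  ((kerAdjoint V).starProjection : F →ₗ[ℂ] F) ∘ₗ cayley B hB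

end Symmetric

end AbstractWave

/-! Let `c = I` for `D₊` and `c = -I` for `D₋`. For `u ∈ D(B²)` the vector `[u; cBu]` has energy
`(B²u, u) + ‖Bu‖² = 2‖Bu‖²`, so `Bu ↦ [u; cBu]/√2` extends to an isometry `J` of `F` (here `𝔥₀`)
onto `D±`, with `J V F = D±^V`. Simplicity enters only here: it makes the vectors `Bu` dense. On
smooth vectors the generator `A` of `W` satisfies `A J = J cB`. Hence its Cayley transform `C = (A +
1)(A - 1)⁻¹` satisfies `C J = J T` when `c = I`, and `C⁻¹ J = J T` when `c = -I`. Moreover `C` and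
`W` have the same closed reducing subspaces. With `U = C` or `C⁻¹`, the question becomes whether `J
F` lies in the smallest closed `U`-reducing subspace containing `D' = J V F`. As `T` commutes with
`V`, `U D' ⊆ D'`, and that smallest subspace is the set of `x` with `dist(Uⁿx, D') → 0`. For `x = J
f` this distance is `‖P Tⁿ f‖`, where `P` projects onto `ker V†`. Since `T` preserves `V F`, `P T =
P T P`, so `P Tⁿ f = (P T)ⁿ P f`, which gives the criterion. The carrying lemmas are
`IsUnitaryGroup.cogenerator_mem`, `IsUnitaryGroup.apply_mem_of_cogenerator`,
`asymptoticallyEquivalent_range_iff`, `exists_energy_isometry` and `cogenerator_energy_isometry`. -/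

namespace AbstractWave

/-! ### Unitary groups, their generators and Cayley transforms. -/

section UnitaryGroup

variable {H : Type*} [NormedAddCommGroup H] [InnerProductSpace ℂ H]

/-- The graph of the generator of a one-parameter group. -/
noncomputable def generatorGraph (W : ℝ → H ≃ₗᵢ[ℂ] H) : Submodule ℂ (H × H) where
  carrier := {p | HasDerivAt (fun t : ℝ => W t p.1) p.2 0}
  zero_mem' := by
    have : (fun t : ℝ => W t (0 : H)) = fun _ => 0 := by ext t; simp
    simpa [this] using hasDerivAt_const (0 : ℝ) (0 : H)
  add_mem' := by
    intro p q hp hq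
    have := HasDerivAt.add hp hq
    refine this.congr_of_eventuallyEq (Eventually.of_forall fun t => ?_)
    exact map_add (W t) _ _
  smul_mem' := by
    intro c p hp
    have := HasDerivAt.const_smul c hp
    refine this.congr_of_eventuallyEq (Eventually.of_forall fun t => ?_)
    exact map_smul (W t) _ _

theorem mem_generatorGraph {W : ℝ → H ≃ₗᵢ[ℂ] H} {x y : H} :
    (x, y) ∈ generatorGraph W ↔ HasDerivAt (fun t : ℝ => W t x) y 0 := Iff.rfl

/-- A one-parameter group of unitary operators with closed, densely defined generator. -/
structure IsUnitaryGroup (W : ℝ → H ≃ₗᵢ[ℂ] H) : Prop where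
  map_zero : ∀ x, W 0 x = x
  map_add : ∀ s t x, W (s + t) x = W s (W t x)
  closed : IsClosed (generatorGraph W : Set (H × H))
  dense : Dense {x | ∃ y, (x, y) ∈ generatorGraph W}

namespace IsUnitaryGroup

variable {W : ℝ → H ≃ₗᵢ[ℂ] H}

theorem apply_neg_apply (hW : IsUnitaryGroup W) (t : ℝ) (x : H) : W t (W (-t) x) = x := by
  rw [← hW.map_add, add_neg_cancel, hW.map_zero]

theorem hasDerivAt (hW : IsUnitaryGroup W) {x y : H} (h : (x, y) ∈ generatorGraph W) (t : ℝ) :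
    HasDerivAt (fun s : ℝ => W s x) (W t y) t := by
  have h0 : HasDerivAt (fun s : ℝ => W s x) y (t - t) := by rw [sub_self]; exact h
  have h2 : HasDerivAt (fun s : ℝ => W (s - t) x) y t := h0.comp_sub_const t t
  have h3 := (((W t).toContinuousLinearEquiv : H →L[ℂ] H).restrictScalars ℝ).hasFDerivAt.comp_hasDerivAt
    t h2
  refine h3.congr_of_eventuallyEq (Eventually.of_forall fun s => ?_)
  change W s x = W t (W (s - t) x)
  rw [← hW.map_add, add_sub_cancel]

theorem apply_mem (hW : IsUnitaryGroup W) {x y : H} (h : (x, y) ∈ generatorGraph W) (t : ℝ) :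
    (W t x, W t y) ∈ generatorGraph W := by
  have h1 : HasDerivAt (fun s : ℝ => W s x) (W t y) (0 + t) := by
    rw [zero_add]; exact hW.hasDerivAt h t
  have h2 : HasDerivAt (fun s : ℝ => W (s + t) x) (W t y) 0 := h1.comp_add_const 0 t
  rw [mem_generatorGraph]
  simpa only [hW.map_add] using h2

theorem inner_add_inner_eq_zero (hW : IsUnitaryGroup W) {x y : H}
    (h : (x, y) ∈ generatorGraph W) : ⟪x, y⟫_ℂ + ⟪y, x⟫_ℂ = 0 := by
  have h1 := HasDerivAt.inner ℂ (mem_generatorGraph.1 h) (mem_generatorGraph.1 h)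
  simp only [LinearIsometryEquiv.inner_map_map, hW.map_zero] at h1
  exact h1.unique (hasDerivAt_const _ _)

theorem norm_add_smul_sq (hW : IsUnitaryGroup W) {x y : H} (h : (x, y) ∈ generatorGraph W)
    {s : ℝ} (hs : s * s = 1) : ‖y + (s : ℂ) • x‖ ^ 2 = ‖y‖ ^ 2 + ‖x‖ ^ 2 := by
  have h0 : (⟪y, x⟫_ℂ).re = 0 := by
    have h1 := congrArg Complex.re (hW.inner_add_inner_eq_zero h)
    rw [← inner_conj_symm x y, Complex.add_re, Complex.conj_re, Complex.zero_re] at h1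
    linarith
  have hs' : ‖(s : ℂ)‖ = 1 := by
    rw [Complex.norm_real, Real.norm_eq_abs, ← abs_one]
    exact (sq_eq_sq_iff_abs_eq_abs s 1).1 (by nlinarith)
  rw [@norm_add_sq ℂ, norm_smul, hs', one_mul, inner_smul_right]
  simp [h0]

variable [CompleteSpace H]

/-- The range of `A + s` is closed because `A + s` is bounded below on a closed graph. If `w` is
orthogonal to it, `⟪w, W t x⟫` solves `f' = -s f`, hence is a multiple of `exp (-s t)`; being
bounded on the whole line, it vanishes. -/
theorem surjective_add_smul (hW : IsUnitaryGroup W) {s : ℝ} (hs : s * s = 1) (z : H) :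
    ∃ x y, (x, y) ∈ generatorGraph W ∧ y + (s : ℂ) • x = z := by
  let φ : generatorGraph W →L[ℂ] H :=
    (ContinuousLinearMap.snd ℂ H H + (s : ℂ) • ContinuousLinearMap.fst ℂ H H) ∘L
      (generatorGraph W).subtypeL
  have hφa : ∀ p : generatorGraph W, φ p = p.1.2 + (s : ℂ) • p.1.1 := fun p => rfl
  have hanti : AntilipschitzWith 1 φ := by
    refine AddMonoidHomClass.antilipschitz_of_bound φ fun p => ?_
    have h := hW.norm_add_smul_sq p.2 hs
    rw [NNReal.coe_one, one_mul, hφa]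
    change max ‖p.1.1‖ ‖p.1.2‖ ≤ _
    apply max_le <;> apply le_of_sq_le_sq _ (norm_nonneg _) <;> rw [h] <;> nlinarith [sq_nonneg ‖p.1.1‖, sq_nonneg ‖p.1.2‖]
  have : CompleteSpace (generatorGraph W) := hW.closed.completeSpace_coe
  have hclosed : IsClosed (φ.range : Set H) := hanti.isClosed_range φ.uniformContinuous
  have hbot : (φ.range)ᗮ = ⊥ := by
    rw [eq_bot_iff]
    intro w hw
    have horth : ∀ x y, (x, y) ∈ generatorGraph W → ⟪w, y⟫_ℂ = -((s : ℂ) * ⟪w, x⟫_ℂ) := by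
      intro x y hxy
      have h1 : ⟪w, y + (s : ℂ) • x⟫_ℂ = 0 := by
        rw [← inner_conj_symm, hw (y + (s : ℂ) • x) ⟨⟨(x, y), hxy⟩, rfl⟩, _root_.map_zero]
      rw [inner_add_right, inner_smul_right] at h1
      linear_combination h1
    have hzero : ∀ x y, (x, y) ∈ generatorGraph W → ⟪w, x⟫_ℂ = 0 := by
      intro x y hxy
      have hd : ∀ t : ℝ, HasDerivAt
          (fun t : ℝ => Complex.exp ((s : ℂ) * t) * ⟪w, W t x⟫_ℂ) 0 t := by
        intro t
        have h1 := HasDerivAt.inner ℂ (hasDerivAt_const t w) (hW.hasDerivAt hxy t)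
        have h2 : HasDerivAt (fun t : ℝ => Complex.exp ((s : ℂ) * t))
            (Complex.exp ((s : ℂ) * t) * s) t := by
          have := (((hasDerivAt_id (t : ℂ)).const_mul (s : ℂ)).cexp).comp_ofReal
          simpa using this
        have h3 := h2.mul h1
        rw [horth _ _ (hW.apply_mem hxy t), inner_zero_left] at h3
        have h4 : Complex.exp ((s : ℂ) * t) * s * ⟪w, W t x⟫_ℂ +
            Complex.exp ((s : ℂ) * t) * (-((s : ℂ) * ⟪w, W t x⟫_ℂ) + 0) = 0 := by ring
        rwa [h4] at h3
      have hconst : ∀ t : ℝ, Complex.exp ((s : ℂ) * t) * ⟪w, W t x⟫_ℂ = ⟪w, x⟫_ℂ := by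
        intro t
        have := is_const_of_deriv_eq_zero (fun t => (hd t).differentiableAt)
          (fun t => (hd t).deriv) t 0
        simpa [hW.map_zero] using this
      have hbound : ∀ τ : ℝ, ‖⟪w, x⟫_ℂ‖ ≤ Real.exp (-τ) * (‖w‖ * ‖x‖) := by
        intro τ
        -- The time `-s τ` turns the factor `exp (s t)` into `exp (-τ)` for either sign, since `s² =
        -- 1`.
        rw [← hconst (-s * τ), norm_mul, Complex.norm_exp]
        have h1 : ((s : ℂ) * ((-s * τ : ℝ) : ℂ)).re = -τ := by
          rw [← Complex.ofReal_mul, Complex.ofReal_re]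
          linear_combination (-τ) * hs
        rw [h1]
        gcongr
        refine (norm_inner_le_norm _ _).trans ?_
        rw [LinearIsometryEquiv.norm_map]
      have hlim : Tendsto (fun τ : ℝ => Real.exp (-τ) * (‖w‖ * ‖x‖)) atTop (𝓝 0) := by
        simpa using (Real.tendsto_exp_neg_atTop_nhds_zero).mul_const (‖w‖ * ‖x‖)
      exact norm_le_zero_iff.1 (ge_of_tendsto' hlim hbound)
    have h2 : Set.EqOn (fun x => ⟪w, x⟫_ℂ) (fun _ => 0) {x | ∃ y, (x, y) ∈ generatorGraph W} :=
      fun x ⟨y, hxy⟩ => hzero x y hxy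
    have h3 := Continuous.ext_on hW.dense (by fun_prop) (by fun_prop) h2
    exact inner_self_eq_zero.1 (congrFun h3 w)
  have htop : φ.range = ⊤ := by
    have : CompleteSpace φ.range := hclosed.completeSpace_coe
    rwa [Submodule.orthogonal_eq_bot_iff] at hbot
  obtain ⟨p, hp⟩ := LinearMap.range_eq_top.mp htop z
  exact ⟨p.1.1, p.1.2, p.2, hp⟩

theorem bijective_add_smul (hW : IsUnitaryGroup W) {s : ℝ} (hs : s * s = 1) :
    Function.Bijective ((LinearMap.snd ℂ H H + (s : ℂ) • LinearMap.fst ℂ H H) ∘ₗ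
      (generatorGraph W).subtype) := by
  constructor
  · rw [injective_iff_map_eq_zero]
    rintro ⟨⟨x, y⟩, hxy⟩ h
    have h1 := hW.norm_add_smul_sq hxy hs
    have h2 : y + (s : ℂ) • x = 0 := h
    rw [h2, norm_zero] at h1
    have hx : ‖x‖ = 0 := by nlinarith [sq_nonneg ‖x‖, sq_nonneg ‖y‖]
    have hy : ‖y‖ = 0 := by nlinarith [sq_nonneg ‖x‖, sq_nonneg ‖y‖]
    exact Subtype.ext (Prod.ext (norm_eq_zero.1 hx) (norm_eq_zero.1 hy))
  · intro z
    obtain ⟨x, y, hxy, h⟩ := hW.surjective_add_smul hs z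
    exact ⟨⟨(x, y), hxy⟩, h⟩

/-- The Cayley transform `(A + 1)(A - 1)⁻¹` of the generator `A` of a unitary group. -/
theorem exists_cogenerator (hW : IsUnitaryGroup W) :
    ∃ C : H ≃ₗᵢ[ℂ] H, ∀ x y, (x, y) ∈ generatorGraph W → C (y - x) = y + x := by
  have hm : (-1 : ℝ) * (-1) = 1 := by norm_num
  have hp : (1 : ℝ) * 1 = 1 := by norm_num
  let e₁ := LinearEquiv.ofBijective _ (hW.bijective_add_smul hm)
  let e₂ := LinearEquiv.ofBijective _ (hW.bijective_add_smul hp)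
  have he₁ : ∀ p, e₁ p = p.1.2 - p.1.1 := fun p => by
    change p.1.2 + ((-1 : ℝ) : ℂ) • p.1.1 = _
    simp [sub_eq_add_neg]
  have he₂ : ∀ p, e₂ p = p.1.2 + p.1.1 := fun p => by
    change p.1.2 + ((1 : ℝ) : ℂ) • p.1.1 = _
    simp
  refine ⟨⟨e₁.symm.trans e₂, fun z => ?_⟩, fun x y hxy => ?_⟩
  · obtain ⟨p, rfl⟩ := e₁.surjective z
    rw [LinearEquiv.trans_apply, LinearEquiv.symm_apply_apply, he₁, he₂]
    -- Both `y - x` and `y + x` have squared norm `‖y‖² + ‖x‖²`.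
    rw [← sq_eq_sq₀ (norm_nonneg _) (norm_nonneg _)]
    have h1 := hW.norm_add_smul_sq p.2 hm
    have h2 := hW.norm_add_smul_sq p.2 hp
    simp only [Complex.ofReal_one, Complex.ofReal_neg, one_smul, neg_smul, ← sub_eq_add_neg] at h1 h2
    rw [h1, h2]
  · rw [← he₁ ⟨(x, y), hxy⟩]
    change (e₁.symm.trans e₂) _ = _
    rw [LinearEquiv.trans_apply, LinearEquiv.symm_apply_apply, he₂]

end IsUnitaryGroup

/-! ### Common reducing subspaces of the group and its Cayley transform; orbit spans. -/

section Invariance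

variable {W : ℝ → H ≃ₗᵢ[ℂ] H} {C : H ≃ₗᵢ[ℂ] H}

/-- The orthogonal projection onto a subspace that reduces a unitary operator commutes with it. -/
theorem starProjection_apply_comm {U : H ≃ₗᵢ[ℂ] H} {M : Submodule ℂ H}
    [M.HasOrthogonalProjection] (h : ∀ x ∈ M, U x ∈ M) (h' : ∀ x ∈ M, U.symm x ∈ M) (x : H) :
    M.starProjection (U x) = U (M.starProjection x) := by
  refine Submodule.eq_starProjection_of_mem_orthogonal (h _ (M.starProjection_apply_mem x)) ?_
  intro m hm
  rw [← map_sub, ← U.apply_symm_apply m, LinearIsometryEquiv.inner_map_map]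
  exact M.sub_starProjection_mem_orthogonal x _ (h' m hm)

/-- The projection onto `M` commutes with every `W t`, hence maps the graph of the generator to
itself. Projecting a representation `z = y ∓ x` of `z ∈ M` therefore gives another one with both
entries in `M`. -/
theorem IsUnitaryGroup.cogenerator_mem [CompleteSpace H] (hW : IsUnitaryGroup W)
    (hC : ∀ x y, (x, y) ∈ generatorGraph W → C (y - x) = y + x)
    {M : Submodule ℂ H} [M.HasOrthogonalProjection] (hM : ∀ t, ∀ x ∈ M, W t x ∈ M) :
    (∀ x ∈ M, C x ∈ M) ∧ ∀ x ∈ M, C.symm x ∈ M := by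
  have hP : ∀ x y, (x, y) ∈ generatorGraph W →
      (M.starProjection x, M.starProjection y) ∈ generatorGraph W := by
    intro x y hxy
    have h1 := (M.starProjection.restrictScalars ℝ).hasFDerivAt.comp_hasDerivAt (0 : ℝ)
      (mem_generatorGraph.1 hxy)
    rw [mem_generatorGraph]
    refine h1.congr_of_eventuallyEq (Eventually.of_forall fun t => ?_)
    refine (starProjection_apply_comm (hM t) (fun z hz => ?_) x).symm
    have : (W t).symm z = W (-t) z := by
      rw [LinearIsometryEquiv.symm_apply_eq, hW.apply_neg_apply]
    rw [this]
    exact hM _ _ hz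
  constructor
  · intro z hz
    obtain ⟨x, y, hxy, h⟩ := hW.surjective_add_smul (s := -1) (by norm_num) z
    have h1 : y - x = z := by rw [← h]; simp [sub_eq_add_neg]
    have h2 : M.starProjection y - M.starProjection x = z := by
      rw [← map_sub, h1, Submodule.starProjection_eq_self_iff.2 hz]
    rw [← h2, hC _ _ (hP x y hxy)]
    exact add_mem (M.starProjection_apply_mem y) (M.starProjection_apply_mem x)
  · intro z hz
    obtain ⟨x, y, hxy, h⟩ := hW.surjective_add_smul (s := 1) (by norm_num) z
    have h1 : y + x = z := by rw [← h]; simp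
    have h2 : M.starProjection y + M.starProjection x = z := by
      rw [← _root_.map_add, h1, Submodule.starProjection_eq_self_iff.2 hz]
    rw [← h2, ← hC _ _ (hP x y hxy), LinearIsometryEquiv.symm_apply_apply]
    exact sub_mem (M.starProjection_apply_mem y) (M.starProjection_apply_mem x)

/-- The projection `P` onto `M` commutes with `C`, hence preserves the graph of the generator. It
then commutes with `W t` by uniqueness for the Cauchy problem: `W t P x - P W t x` is a solution
starting at `0`, and the norm of a solution is constant. -/
theorem IsUnitaryGroup.apply_mem_of_cogenerator [CompleteSpace H] (hW : IsUnitaryGroup W)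
    (hC : ∀ x y, (x, y) ∈ generatorGraph W → C (y - x) = y + x)
    {M : Submodule ℂ H} [M.HasOrthogonalProjection]
    (hM : ∀ x ∈ M, C x ∈ M) (hM' : ∀ x ∈ M, C.symm x ∈ M) (t : ℝ) {x : H} (hx : x ∈ M) :
    W t x ∈ M := by
  have hP : ∀ x y, (x, y) ∈ generatorGraph W →
      (M.starProjection x, M.starProjection y) ∈ generatorGraph W := by
    intro x y hxy
    -- Solve `y' - x' = P (y - x)`; applying `C` gives `y' + x' = P (y + x)`, and the two equations
    -- force `x' = P x`, `y' = P y`.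
    obtain ⟨x', y', hxy', h⟩ := hW.surjective_add_smul (s := -1) (by norm_num)
      (M.starProjection (y - x))
    have h1 : y' - x' = M.starProjection (y - x) := by rw [← h]; simp [sub_eq_add_neg]
    have h2 : y' + x' = M.starProjection (y + x) := by
      rw [← hC _ _ hxy', h1, ← hC _ _ hxy, starProjection_apply_comm hM hM']
    rw [map_sub] at h1
    rw [_root_.map_add] at h2
    have hy : y' = M.starProjection y := by
      have : (2 : ℂ) • y' = (2 : ℂ) • M.starProjection y := by
        calc (2 : ℂ) • y' = (y' - x') + (y' + x') := by rw [two_smul]; abel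
          _ = (2 : ℂ) • M.starProjection y := by rw [h1, h2, two_smul]; abel
      exact smul_right_injective H (two_ne_zero' ℂ) this
    have hx : x' = M.starProjection x := by
      rw [hy] at h2; exact add_left_cancel h2
    rwa [hx, hy] at hxy'
  have hcomm : ∀ x, W t (M.starProjection x) = M.starProjection (W t x) := by
    have hcl : IsClosed {x | W t (M.starProjection x) = M.starProjection (W t x)} :=
      isClosed_eq ((W t).continuous.comp M.starProjection.continuous)
        (M.starProjection.continuous.comp (W t).continuous)
    intro x
    refine hcl.closure_subset_iff.2 ?_ (hW.dense x)
    rintro x ⟨y, hxy⟩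
    have hu : ∀ r, HasDerivAt (fun r => W r (M.starProjection x) - M.starProjection (W r x))
        (W r (M.starProjection y) - M.starProjection (W r y)) r := fun r =>
      (hW.hasDerivAt (hP x y hxy) r).sub
        ((M.starProjection.restrictScalars ℝ).hasFDerivAt.comp_hasDerivAt r (hW.hasDerivAt hxy r))
    have hg : ∀ r, (W r (M.starProjection x) - M.starProjection (W r x),
        W r (M.starProjection y) - M.starProjection (W r y)) ∈ generatorGraph W := fun r =>
      sub_mem (hW.apply_mem (hP x y hxy) r) (hP _ _ (hW.apply_mem hxy r))
    have hd : ∀ r, HasDerivAt (fun r => ⟪W r (M.starProjection x) - M.starProjection (W r x),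
        W r (M.starProjection x) - M.starProjection (W r x)⟫_ℂ) 0 r := by
      intro r
      have := HasDerivAt.inner ℂ (hu r) (hu r)
      rwa [hW.inner_add_inner_eq_zero (hg r)] at this
    have hc := is_const_of_deriv_eq_zero (fun r => (hd r).differentiableAt)
      (fun r => (hd r).deriv) t 0
    simp only [hW.map_zero, sub_self, inner_zero_left, inner_self_eq_zero] at hc
    exact sub_eq_zero.1 hc
  have := hcomm x
  rw [Submodule.starProjection_eq_self_iff.2 hx] at this
  rw [this]
  exact M.starProjection_apply_mem _

/-- The closed linear span of the orbit of `D`. -/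
noncomputable def orbitSpan (W : ℝ → H ≃ₗᵢ[ℂ] H) (D : Submodule ℂ H) : Submodule ℂ H :=
  (⨆ t : ℝ, D.map ((W t).toLinearEquiv : H →ₗ[ℂ] H)).topologicalClosure

theorem IsUnitaryGroup.le_orbitSpan (hW : IsUnitaryGroup W) (D : Submodule ℂ H) :
    D ≤ orbitSpan W D := by
  intro x hx
  refine Submodule.le_topologicalClosure _ (Submodule.mem_iSup_of_mem 0 ⟨x, hx, hW.map_zero x⟩)

theorem IsUnitaryGroup.apply_mem_orbitSpan (hW : IsUnitaryGroup W) (D : Submodule ℂ H) (t : ℝ)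
    {x : H} (hx : x ∈ orbitSpan W D) : W t x ∈ orbitSpan W D := by
  have h : (⨆ s : ℝ, D.map ((W s).toLinearEquiv : H →ₗ[ℂ] H)) ≤
      (⨆ s : ℝ, D.map ((W s).toLinearEquiv : H →ₗ[ℂ] H)).comap
        ((W t).toLinearEquiv : H →ₗ[ℂ] H) := by
    refine iSup_le fun s => ?_
    rintro _ ⟨d, hd, rfl⟩
    refine Submodule.mem_iSup_of_mem (t + s) ⟨d, hd, ?_⟩
    exact hW.map_add t s d
  exact map_mem_closure (W t).continuous hx fun y hy => h hy

theorem orbitSpan_le {D M : Submodule ℂ H} (hcl : IsClosed (M : Set H)) (hD : D ≤ M)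
    (hM : ∀ t, ∀ x ∈ M, W t x ∈ M) : orbitSpan W D ≤ M := by
  refine Submodule.topologicalClosure_minimal _ (iSup_le fun t => ?_) hcl
  rintro _ ⟨d, hd, rfl⟩
  exact hM t d (hD hd)

/-- The vectors whose orbit under `C` approaches `D`. -/
noncomputable def asymptoticSubspace (C : H ≃ₗᵢ[ℂ] H) (D : Submodule ℂ H)
    [D.HasOrthogonalProjection] : Submodule ℂ H where
  carrier := {x | Tendsto (fun n : ℕ => Dᗮ.starProjection (C^[n] x)) atTop (𝓝 0)}
  zero_mem' := by
    have : ∀ n : ℕ, C^[n] (0 : H) = 0 := fun n => iterate_map_zero C n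
    simp [this]
  add_mem' := by
    intro x y hx hy
    have : ∀ n : ℕ, C^[n] (x + y) = C^[n] x + C^[n] y := fun n => iterate_map_add C n x y
    change Tendsto (fun n : ℕ => Dᗮ.starProjection (C^[n] (x + y))) atTop (𝓝 0)
    simp only [this, map_add]
    simpa only [add_zero] using Tendsto.add hx hy
  smul_mem' := by
    intro c x hx
    have : ∀ n : ℕ, C^[n] (c • x) = c • C^[n] x := fun n => by
      induction n with
      | zero => rfl
      | succ n ih => rw [Function.iterate_succ_apply', ih, Function.iterate_succ_apply', map_smul]
    change Tendsto (fun n : ℕ => Dᗮ.starProjection (C^[n] (c • x))) atTop (𝓝 0)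
    simp only [this, map_smul]
    simpa only [smul_zero] using Tendsto.const_smul hx c

theorem norm_iterate (C : H ≃ₗᵢ[ℂ] H) (n : ℕ) (x : H) : ‖C^[n] x‖ = ‖x‖ := by
  induction n with
  | zero => rfl
  | succ n ih => rw [Function.iterate_succ_apply', LinearIsometryEquiv.norm_map, ih]

/-- The maps `x ↦ Dᗮ.starProjection (C^[n] x)` are contractions for every `n`, so convergence to `0`
survives limits in `x`. -/
theorem isClosed_asymptoticSubspace (C : H ≃ₗᵢ[ℂ] H) (D : Submodule ℂ H)
    [D.HasOrthogonalProjection] : IsClosed (asymptoticSubspace C D : Set H) := by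
  refine isClosed_of_closure_subset fun x hx => ?_
  change Tendsto (fun n : ℕ => Dᗮ.starProjection (C^[n] x)) atTop (𝓝 0)
  rw [Metric.tendsto_atTop]
  intro ε hε
  obtain ⟨y, hy, hxy⟩ := Metric.mem_closure_iff.1 hx (ε / 2) (half_pos hε)
  obtain ⟨N, hN⟩ := Metric.tendsto_atTop.1
    (show Tendsto (fun n : ℕ => Dᗮ.starProjection (C^[n] y)) atTop (𝓝 0) from hy) (ε / 2)
    (half_pos hε)
  refine ⟨N, fun n hn => ?_⟩
  have h1 := hN n hn
  rw [dist_zero_right] at h1 ⊢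
  have h2 : ‖Dᗮ.starProjection (C^[n] x) - Dᗮ.starProjection (C^[n] y)‖ ≤ ‖x - y‖ := by
    rw [← map_sub, ← iterate_map_sub]
    exact (Submodule.norm_starProjection_apply_le _ _).trans (norm_iterate C n _).le
  rw [dist_eq_norm] at hxy
  calc ‖Dᗮ.starProjection (C^[n] x)‖
      ≤ ‖Dᗮ.starProjection (C^[n] x) - Dᗮ.starProjection (C^[n] y)‖
        + ‖Dᗮ.starProjection (C^[n] y)‖ := norm_le_norm_sub_add _ _
    _ < ε := by linarith

/-- Applying `C` only shifts the sequence by one index; the equivalence gives invariance under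
`C.symm` as well. -/
theorem apply_mem_asymptoticSubspace (C : H ≃ₗᵢ[ℂ] H) (D : Submodule ℂ H)
    [D.HasOrthogonalProjection] (x : H) :
    C x ∈ asymptoticSubspace C D ↔ x ∈ asymptoticSubspace C D := by
  change Tendsto (fun n : ℕ => Dᗮ.starProjection (C^[n] (C x))) atTop (𝓝 0) ↔
    Tendsto (fun n : ℕ => Dᗮ.starProjection (C^[n] x)) atTop (𝓝 0)
  simp only [← Function.iterate_succ_apply]
  exact tendsto_add_atTop_iff_nat (f := fun n : ℕ => Dᗮ.starProjection (C^[n] x)) 1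

theorem le_asymptoticSubspace {C : H ≃ₗᵢ[ℂ] H} {D : Submodule ℂ H}
    [D.HasOrthogonalProjection] (h : ∀ x ∈ D, C x ∈ D) : D ≤ asymptoticSubspace C D := by
  intro x hx
  have hn : ∀ n : ℕ, C^[n] x ∈ D := fun n => by
    induction n with
    | zero => exact hx
    | succ n ih => rw [Function.iterate_succ_apply']; exact h _ ih
  change Tendsto (fun n : ℕ => Dᗮ.starProjection (C^[n] x)) atTop (𝓝 0)
  have : ∀ n : ℕ, Dᗮ.starProjection (C^[n] x) = 0 := fun n =>
    (Submodule.starProjection_apply_eq_zero_iff _).2 (Submodule.le_orthogonal_orthogonal D (hn n))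
  simp [this]

end Invariance
end UnitaryGroup
-- Compression to `ker V†` and the abstract criterion.
section Isometry

variable {F : Type*} [NormedAddCommGroup F] [InnerProductSpace ℂ F] [CompleteSpace F]

theorem inner_apply_eq_zero_of_mem_kerAdjoint {V : F →ₗᵢ[ℂ] F} {m : F} (hm : m ∈ kerAdjoint V)
    (g : F) : ⟪V g, m⟫_ℂ = 0 := by
  have h : ContinuousLinearMap.adjoint V.toContinuousLinearMap m = 0 := hm
  have h2 := ContinuousLinearMap.adjoint_inner_right V.toContinuousLinearMap g m
  rw [h, inner_zero_right] at h2
  exact h2.symm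

theorem starProjection_kerAdjoint_apply (V : F →ₗᵢ[ℂ] F) (g : F) :
    (kerAdjoint V).starProjection (V g) = 0 := by
  rw [Submodule.starProjection_apply_eq_zero_iff, Submodule.mem_orthogonal']
  exact fun m hm => inner_apply_eq_zero_of_mem_kerAdjoint hm g

theorem exists_eq_starProjection_add (V : F →ₗᵢ[ℂ] F) (f : F) :
    ∃ g, f = (kerAdjoint V).starProjection f + V g := by
  have hcl : IsClosed (V.toLinearMap.range : Set F) := V.isometry.isClosedEmbedding.isClosed_range
  have : CompleteSpace V.toLinearMap.range := hcl.completeSpace_coe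
  have h : (kerAdjoint V)ᗮ = V.toLinearMap.range := by
    have h1 : kerAdjoint V = V.toLinearMap.rangeᗮ := by
      ext m
      constructor
      · rintro hm _ ⟨g, rfl⟩
        exact inner_apply_eq_zero_of_mem_kerAdjoint hm g
      · intro hm
        refine ext_inner_left ℂ fun g => ?_
        rw [inner_zero_right]
        exact (ContinuousLinearMap.adjoint_inner_right V.toContinuousLinearMap g m).trans
          (hm _ ⟨g, rfl⟩)
    rw [h1, Submodule.orthogonal_orthogonal]
  obtain ⟨g, hg⟩ : f - (kerAdjoint V).starProjection f ∈ V.toLinearMap.range :=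
    h ▸ (kerAdjoint V).sub_starProjection_mem_orthogonal f
  refine ⟨g, ?_⟩
  have : V g = f - (kerAdjoint V).starProjection f := hg
  rw [this, add_sub_cancel]

/-- Compressions of the powers of `T` to `ker V†` are powers of the compression of `T`. -/
theorem starProjection_pow_apply {T : F →ₗ[ℂ] F} {V : F →ₗᵢ[ℂ] F} (hTV : ∀ f, T (V f) = V (T f))
    (n : ℕ) (f : F) :
    (kerAdjoint V).starProjection (T^[n] f) =
      ((((kerAdjoint V).starProjection : F →ₗ[ℂ] F) ∘ₗ T : Module.End ℂ F) ^ n)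
        ((kerAdjoint V).starProjection f) := by
  induction n with
  | zero => simp
  | succ n ih =>
    rw [pow_succ', Module.End.mul_apply, ← ih, Function.iterate_succ_apply']
    -- The component `V g` is lost after one more step: `T (V g) = V (T g)` is annihilated by the
    -- projection.
    obtain ⟨g, hg⟩ := exists_eq_starProjection_add V (T^[n] f)
    conv_lhs => rw [hg, _root_.map_add, hTV, _root_.map_add, starProjection_kerAdjoint_apply, add_zero]
    rfl

variable {H : Type*} [NormedAddCommGroup H] [InnerProductSpace ℂ H]

theorem starProjection_orthogonal_range_comp (J : F →ₗᵢ[ℂ] H) (V : F →ₗᵢ[ℂ] F)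
    [((J.comp V).toLinearMap.range).HasOrthogonalProjection] (f : F) :
    ((J.comp V).toLinearMap.range)ᗮ.starProjection (J f) =
      J ((kerAdjoint V).starProjection f) := by
  refine Submodule.eq_starProjection_of_mem_orthogonal ?_ ?_
  · rintro _ ⟨g, rfl⟩
    change ⟪J (V g), _⟫_ℂ = 0
    rw [LinearIsometry.inner_map_map]
    exact inner_apply_eq_zero_of_mem_kerAdjoint (Submodule.starProjection_apply_mem _ _) g
  · obtain ⟨g, hg⟩ := exists_eq_starProjection_add V f
    refine Submodule.le_orthogonal_orthogonal _ ⟨g, ?_⟩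
    change J (V g) = _
    rw [← map_sub, sub_eq_of_eq_add' hg]

/-- An abstract version of the criterion: `U` is a unitary operator with the same closed reducing
subspaces as the group `W`, and `T` is its restriction to the invariant subspace `J F`. -/
theorem asymptoticallyEquivalent_range_iff [CompleteSpace H] {W : ℝ → H ≃ₗᵢ[ℂ] H} (hW : IsUnitaryGroup W)
    {U : H ≃ₗᵢ[ℂ] H}
    (hU : ∀ M : Submodule ℂ H, IsClosed (M : Set H) →
      ((∀ t, ∀ x ∈ M, W t x ∈ M) ↔ (∀ x ∈ M, U x ∈ M) ∧ ∀ x ∈ M, U.symm x ∈ M))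
    {J : F →ₗᵢ[ℂ] H} {T : F →ₗ[ℂ] F} (hJ : ∀ f, U (J f) = J (T f))
    {V : F →ₗᵢ[ℂ] F} (hTV : ∀ f, T (V f) = V (T f)) :
    AsymptoticallyEquivalent W J.toLinearMap.range (J.comp V).toLinearMap.range ↔
      ∀ γ ∈ kerAdjoint V, Tendsto
        (fun n : ℕ => ‖((((kerAdjoint V).starProjection : F →ₗ[ℂ] F) ∘ₗ T : Module.End ℂ F) ^ n) γ‖)
        atTop (𝓝 0) := by
  set D := (J.comp V).toLinearMap.range with hD
  have hDcl : IsClosed (D : Set H) := (J.comp V).isometry.isClosedEmbedding.isClosed_range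
  have : CompleteSpace D := hDcl.completeSpace_coe
  have hDJ : D ≤ J.toLinearMap.range := by
    rintro _ ⟨g, rfl⟩
    exact ⟨V g, rfl⟩
  have hJn : ∀ (n : ℕ) (f : F), U^[n] (J f) = J (T^[n] f) := fun n f => by
    induction n with
    | zero => rfl
    | succ n ih => rw [Function.iterate_succ_apply', ih, hJ, Function.iterate_succ_apply']
  have hDU : ∀ x ∈ D, U x ∈ D := by
    rintro _ ⟨g, rfl⟩
    refine ⟨T g, ?_⟩
    change J (V (T g)) = U (J (V g))
    rw [hJ, hTV]
  have h1 : AsymptoticallyEquivalent W J.toLinearMap.range D ↔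
      J.toLinearMap.range ≤ orbitSpan W D :=
    ⟨fun h => h.1, fun h => ⟨h, hDJ.trans (hW.le_orbitSpan _)⟩⟩
  have h2 : ∀ f, J f ∈ asymptoticSubspace U D ↔
      Tendsto (fun n : ℕ => ‖(kerAdjoint V).starProjection (T^[n] f)‖) atTop (𝓝 0) := by
    intro f
    change Tendsto (fun n : ℕ => Dᗮ.starProjection (U^[n] (J f))) atTop (𝓝 0) ↔ _
    rw [tendsto_zero_iff_norm_tendsto_zero]
    simp only [hJn, hD, starProjection_orthogonal_range_comp, LinearIsometry.norm_map]
  have hspan := (hU (orbitSpan W D) (Submodule.isClosed_topologicalClosure _)).1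
    fun t x hx => hW.apply_mem_orbitSpan D t hx
  -- The asymptotic subspace is closed, reduces `U` and contains `D`, so it contains the orbit span.
  have hle : orbitSpan W D ≤ asymptoticSubspace U D := by
    refine orbitSpan_le (isClosed_asymptoticSubspace U D) (le_asymptoticSubspace hDU) ?_
    refine (hU _ (isClosed_asymptoticSubspace U D)).2
      ⟨fun x hx => (apply_mem_asymptoticSubspace U D x).2 hx, fun x hx => ?_⟩
    rwa [← apply_mem_asymptoticSubspace, LinearIsometryEquiv.apply_symm_apply]
  have hge : asymptoticSubspace U D ≤ orbitSpan W D := by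
    intro x hx
    have hx' : Tendsto (fun n : ℕ => Dᗮ.starProjection (U^[n] x)) atTop (𝓝 0) := hx
    refine (Submodule.isClosed_topologicalClosure _).closure_subset
      (Metric.mem_closure_iff.2 fun ε hε => ?_)
    obtain ⟨n, hn⟩ := (Metric.tendsto_atTop.1 hx' ε hε)
    have hn := hn n le_rfl
    have hmem : ∀ (m : ℕ) (z : H), z ∈ orbitSpan W D → U.symm^[m] z ∈ orbitSpan W D := by
      intro m
      induction m with
      | zero => exact fun z hz => hz
      | succ m ih => exact fun z hz => ih _ (hspan.2 z hz)
    -- Project `Uⁿ x` onto `D` and move back by `U⁻ⁿ`: the result stays in the orbit span, at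
    -- distance `‖Dᗮ.starProjection (Uⁿ x)‖` from `x`.
    refine ⟨U.symm^[n] (D.starProjection (U^[n] x)),
      hmem n _ (hW.le_orbitSpan D (D.starProjection_apply_mem _)), ?_⟩
    have hinv : U.symm^[n] (U^[n] x) = x :=
      Function.LeftInverse.iterate U.symm_apply_apply n x
    rw [dist_zero_right, Submodule.starProjection_orthogonal_val] at hn
    rw [dist_eq_norm]
    nth_rewrite 1 [← hinv]
    rwa [← iterate_map_sub, norm_iterate]
  rw [h1, le_antisymm hle hge]
  constructor
  · intro h γ hγ
    have h3 := (h2 γ).1 (h ⟨γ, rfl⟩)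
    simp only [starProjection_pow_apply hTV, Submodule.starProjection_eq_self_iff.2 hγ] at h3
    exact h3
  · rintro h _ ⟨f, rfl⟩
    refine (h2 f).2 ?_
    simp only [starProjection_pow_apply hTV]
    exact h _ (Submodule.starProjection_apply_mem _ _)

end Isometry

/-! ### Density of ranges and the Cayley transform of `B`. -/

section SymmetricOperator

variable {F : Type*} [NormedAddCommGroup F] [InnerProductSpace ℂ F] [CompleteSpace F]
  {B : F →ₗ.[ℂ] F}

/-- The kernel of `B` is closed, and by symmetry orthogonal to the range, so it reduces `B`. The
part of `B` there is the zero operator, which is self-adjoint; simplicity forces the kernel to be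
trivial. -/
theorem IsSimpleMaximalSymmetric.eq_zero_of_apply_eq_zero (hB : IsSimpleMaximalSymmetric B)
    {u : B.domain} (hu : B u = 0) : u = 0 := by
  set M : Submodule ℂ F := B.toFun.ker.map B.domain.subtype with hM
  have hmem : ∀ x, x ∈ M ↔ ∃ h : x ∈ B.domain, B ⟨x, h⟩ = 0 := by
    intro x
    constructor
    · rintro ⟨v, hv, rfl⟩
      exact ⟨v.2, hv⟩
    · rintro ⟨h, hx⟩
      exact ⟨⟨x, h⟩, hx, rfl⟩
  have hcl : IsClosed (M : Set F) := by
    have : (M : Set F) = (fun x : F => (x, (0 : F))) ⁻¹' (B.graph : Set (F × F)) := by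
      ext x
      rw [SetLike.mem_coe, hmem, Set.mem_preimage, SetLike.mem_coe, LinearPMap.mem_graph_iff]
      constructor
      · rintro ⟨h, hx⟩
        exact ⟨⟨x, h⟩, rfl, hx⟩
      · rintro ⟨⟨y, hy⟩, rfl, hx⟩
        exact ⟨hy, hx⟩
    rw [this]
    exact hB.closed.preimage (by fun_prop)
  have : CompleteSpace M := hcl.completeSpace_coe
  by_contra hne
  have hMne : M ≠ ⊥ := by
    intro h
    have : (u : F) ∈ M := (hmem u).2 ⟨u.2, hu⟩
    rw [h, Submodule.mem_bot] at this
    exact hne (Subtype.ext this)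
  have hproj : ∀ v : B.domain, M.starProjection (B v) = 0 := by
    intro v
    rw [Submodule.starProjection_apply_eq_zero_iff, Submodule.mem_orthogonal]
    intro m hm
    obtain ⟨h, hm0⟩ := (hmem m).1 hm
    have := hB.symm ⟨m, h⟩ v
    rw [hm0, inner_zero_left] at this
    exact this.symm
  refine hB.simple M hMne (fun v => ?_) ?_
  · obtain ⟨h, h0⟩ := (hmem _).1 (M.starProjection_apply_mem (v : F))
    exact ⟨h, by rw [h0, hproj]⟩
  · have hpart : partIn B M = ((0 : M →L[ℂ] M) : M →ₗ[ℂ] M).toPMap ⊤ := by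
      refine LinearPMap.ext ?_ ?_
      · rw [LinearMap.toPMap_domain, eq_top_iff]
        intro x _
        exact ((hmem x).1 x.2).1
      · intro x hx hx'
        obtain ⟨h, h0⟩ := (hmem _).1 x.2
        have : partIn B M ⟨x, hx⟩ = M.orthogonalProjectionOnto (B ⟨x, h⟩) := rfl
        rw [this, h0, _root_.map_zero]
        rfl
    rw [LinearPMap.isSelfAdjoint_def, hpart,
      ContinuousLinearMap.toPMap_adjoint_eq_adjoint_toPMap_of_dense _ (by simp)]
    simp

theorem norm_le_norm_shiftBy (hB : IsSimpleMaximalSymmetric B) (u : B.domain) :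
    ‖B u‖ ≤ ‖shiftBy B I u‖ :=
  le_of_sq_le_sq (by rw [norm_shiftBy_sq hB]; nlinarith [sq_nonneg ‖(u : F)‖]) (norm_nonneg _)

/-- The domain of `B²`, as a subspace of the domain of `B`. -/
noncomputable def squareDomain (B : F →ₗ.[ℂ] F) : Submodule ℂ B.domain :=
  B.domain.comap B.toFun

theorem IsSimpleMaximalSymmetric.denseRange_apply (hB : IsSimpleMaximalSymmetric B) :
    DenseRange fun u : B.domain => B u := by
  have h : B.toFun.rangeᗮ = ⊥ := by
    rw [eq_bot_iff]
    intro φ hφ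
    -- Write `φ = (B + i) u`. As `⟪B u, u⟫` is real, the real part of `⟪B u, φ⟫ = 0` reads `‖B u‖² =
    -- 0`.
    obtain ⟨u, rfl⟩ := (shiftBy_bijective hB).2 φ
    have h1 : ⟪B u, B u + I • (u : F)⟫_ℂ = 0 := hφ _ ⟨u, rfl⟩
    rw [inner_add_right, inner_smul_right] at h1
    have h2 : (⟪B u, (u : F)⟫_ℂ).im = 0 := by
      apply Complex.conj_eq_iff_im.mp
      rw [inner_conj_symm]; exact (hB.symm u u).symm
    have h3 := congrArg Complex.re h1
    rw [inner_self_eq_norm_sq_to_K] at h3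
    simp [h2, ← Complex.ofReal_pow] at h3
    rw [hB.eq_zero_of_apply_eq_zero h3, _root_.map_zero]
    exact Submodule.zero_mem _
  have h2 := (Submodule.topologicalClosure_eq_top_iff (K := B.toFun.range)).2 h
  exact (Submodule.dense_iff_topologicalClosure_eq_top (s := B.toFun.range)).2 h2

/-- The set `D(B²)` is a core for `B`: approximate `(B + i) w` by an element `(B + i) v` of `D(B)`.
Then `v ∈ D(B²)`, and `‖B (v - w)‖ ≤ ‖(B + i)(v - w)‖` is small. -/
theorem IsSimpleMaximalSymmetric.denseRange_square (hB : IsSimpleMaximalSymmetric B) :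
    DenseRange fun u : squareDomain B => B u.1 := by
  refine dense_iff_closure_eq.2 (Set.eq_univ_of_univ_subset ?_)
  rw [← hB.denseRange_apply.closure_range]
  refine closure_minimal ?_ isClosed_closure
  rintro _ ⟨w, rfl⟩
  refine Metric.mem_closure_iff.2 fun ε hε => ?_
  obtain ⟨f, hf, hfw⟩ := Metric.mem_closure_iff.1 (hB.dense (shiftBy B I w)) ε hε
  obtain ⟨v, rfl⟩ := (shiftBy_bijective hB).2 f
  have hv : B v ∈ B.domain := by
    have : B v = shiftBy B I v - I • (v : F) := (add_sub_cancel_right _ _).symm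
    rw [this]
    exact sub_mem hf (Submodule.smul_mem _ _ v.2)
  refine ⟨_, ⟨⟨v, hv⟩, rfl⟩, lt_of_le_of_lt ?_ hfw⟩
  rw [dist_eq_norm, dist_eq_norm, ← LinearPMap.map_sub, ← _root_.map_sub]
  exact norm_le_norm_shiftBy hB _

theorem cayley_shiftBy (hB : IsSimpleMaximalSymmetric B) (u : B.domain) :
    cayley B hB (shiftBy B I u) = shiftBy B (-I) u := by
  change shiftBy B (-I) ((LinearEquiv.ofBijective (shiftBy B I) (shiftBy_bijective hB)).symm
    (LinearEquiv.ofBijective (shiftBy B I) (shiftBy_bijective hB) u)) = _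
  rw [LinearEquiv.symm_apply_apply]

theorem cayley_comm (hB : IsSimpleMaximalSymmetric B) {V : F →ₗᵢ[ℂ] F} (hV : CommutesWith V B)
    (f : F) : cayley B hB (V f) = V (cayley B hB f) := by
  obtain ⟨u, rfl⟩ := (shiftBy_bijective hB).2 f
  obtain ⟨h, hVu⟩ := hV u
  have key : ∀ c : ℂ, V (shiftBy B c u) = shiftBy B c ⟨V u, h⟩ := by
    intro c
    change V (B u + c • (u : F)) = B ⟨V u, h⟩ + c • V u
    rw [hVu, _root_.map_add, map_smul]
  rw [key, cayley_shiftBy, cayley_shiftBy, key]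

theorem norm_cayley (hB : IsSimpleMaximalSymmetric B) (f : F) : ‖cayley B hB f‖ = ‖f‖ := by
  obtain ⟨u, rfl⟩ := (shiftBy_bijective hB).2 f
  rw [cayley_shiftBy, ← sq_eq_sq₀ (norm_nonneg _) (norm_nonneg _), norm_shiftBy_sq hB]
  have h1 : shiftBy B (-I) u = B u - I • (u : F) := by
    rw [sub_eq_add_neg, ← neg_smul]; rfl
  rw [h1, @norm_sub_sq ℂ, norm_smul, Complex.norm_I, one_mul, inner_smul_right]
  have h3 : (⟪B u, (u : F)⟫_ℂ).im = 0 := by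
    apply Complex.conj_eq_iff_im.mp
    rw [inner_conj_symm]; exact (hB.symm u u).symm
  simp [h3]

end SymmetricOperator

/-! ### The energy space: `D±` as isometric copies of `𝔥₀`. -/

section Energy

variable {E : Type*} [NormedAddCommGroup E] [InnerProductSpace ℂ E] [CompleteSpace E]

theorem IsWaveGroup.isUnitaryGroup {L : PositiveSelfAdjoint E}
    {W : ℝ → EnergySpace L ≃ₗᵢ[ℂ] EnergySpace L} (hW : IsWaveGroup L W) : IsUnitaryGroup W where
  map_zero := hW.map_zero
  map_add := hW.map_add
  closed := by
    have : (generatorGraph W : Set (EnergySpace L × EnergySpace L)) =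
        closure {p : EnergySpace L × EnergySpace L | ∃ u v : L.op.domain,
          p = (state L u (v : E), state L v (-L.op u))} :=
      Set.ext fun p => hW.generator p.1 p.2
    rw [this]
    exact isClosed_closure
  dense := by
    have h1 : DenseRange fun u : FormDomain L => (u : FormSpace L) :=
      UniformSpace.Completion.denseRange_coe
    have h2 : DenseRange fun v : L.op.domain => (v : E) := by
      rw [DenseRange, show Set.range (fun v : L.op.domain => (v : E)) = L.op.domain from
        Subtype.range_coe]
      exact L.isSelfAdjoint.dense_domain
    have h3 := (WithLp.homeomorphProd 2 (FormSpace L) E).symm.surjective.denseRange.comp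
      (h1.prodMap h2) (WithLp.homeomorphProd 2 (FormSpace L) E).symm.continuous
    refine Dense.mono ?_ h3
    rintro _ ⟨⟨u, v⟩, rfl⟩
    exact ⟨state L v (-L.op u), (hW.generator _ _).2 (subset_closure ⟨u, v, rfl⟩)⟩

theorem norm_state_sq (L : PositiveSelfAdjoint E) (u : L.op.domain) (v : E) :
    ‖state L u v‖ ^ 2 = (⟪(u : E), L.op u⟫_ℂ).re + ‖v‖ ^ 2 := by
  rw [WithLp.prod_norm_sq_eq_of_L2]
  change ‖((show FormDomain L from u : FormDomain L) : FormSpace L)‖ ^ 2 + _ = _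
  rw [UniformSpace.Completion.norm_coe, @norm_sq_eq_re_inner ℂ (FormDomain L)]
  rfl

variable {F : Type*} [NormedAddCommGroup F] [InnerProductSpace ℂ F] [CompleteSpace F]
  {L : PositiveSelfAdjoint E} {j : F →ₗᵢ[ℂ] E} {B : F →ₗ.[ℂ] F}

theorem norm_state_of_extendsSquare (hB : IsSimpleMaximalSymmetric B)
    (hL : ExtendsSquare L j B) {c : ℂ} (hc : c * c = -1) (u : B.domain) (hu : B u ∈ B.domain)
    (hjL : j u ∈ L.op.domain) :
    ‖state L ⟨j u, hjL⟩ (c • j (B u))‖ = Real.sqrt 2 * ‖B u‖ := by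
  have hc1 : ‖c‖ = 1 := by
    have := congrArg norm hc
    rw [norm_mul, norm_neg, norm_one] at this
    nlinarith [norm_nonneg c]
  rw [← sq_eq_sq₀ (norm_nonneg _) (by positivity), norm_state_sq, norm_smul, hc1, one_mul,
    LinearIsometry.norm_map, mul_pow, Real.sq_sqrt (by norm_num)]
  obtain ⟨_, hLu⟩ := hL u hu
  rw [hLu, LinearIsometry.inner_map_map, ← hB.symm u ⟨B u, hu⟩, inner_self_eq_norm_sq_to_K]
  have : (((‖B u‖ : ℝ) : ℂ) ^ 2).re = ‖B u‖ ^ 2 := by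
    rw [← Complex.ofReal_pow, Complex.ofReal_re]
  refine (congrArg (· + ‖B u‖ ^ 2) this).trans ?_
  ring

/-- The isometry `B u ↦ [u; c B u] / √2`, where `c = ± i`. -/
theorem exists_energy_isometry (hB : IsSimpleMaximalSymmetric B)
    (hL : ExtendsSquare L j B) {c : ℂ} (hc : c * c = -1) :
    ∃ J : F →ₗᵢ[ℂ] EnergySpace L, ∀ (u : B.domain) (_ : B u ∈ B.domain)
      (hjL : j u ∈ L.op.domain),
      state L ⟨j u, hjL⟩ (c • j (B u)) = ((Real.sqrt 2 : ℝ) : ℂ) • J (B u) := by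
  have hs : ((Real.sqrt 2 : ℝ) : ℂ) ≠ 0 := by
    rw [Complex.ofReal_ne_zero]; positivity
  let p : squareDomain B →ₗ[ℂ] F := B.toFun ∘ₗ (squareDomain B).subtype
  let q : squareDomain B →ₗ[ℂ] EnergySpace L :=
    { toFun := fun u => ((Real.sqrt 2 : ℝ) : ℂ)⁻¹ •
        state L ⟨j u.1, (hL u.1 u.2).1⟩ (c • j (B u.1))
      map_add' := fun u v => by
        rw [← smul_add, ← state_add]
        congr 2
        · exact Subtype.ext (j.map_add _ _)
        · rw [← smul_add, ← _root_.map_add, ← LinearPMap.map_add]; rfl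
      map_smul' := fun a u => by
        rw [RingHom.id_apply, smul_comm a, ← state_smul L a]
        congr 2
        · exact Subtype.ext (j.map_smul _ _)
        · rw [smul_comm a, ← map_smul j a, ← LinearPMap.map_smul]; rfl }
  have hq : ∀ u, ‖q u‖ = ‖p u‖ := by
    intro u
    change ‖((Real.sqrt 2 : ℝ) : ℂ)⁻¹ • state L ⟨j u.1, (hL u.1 u.2).1⟩ (c • j (B u.1))‖ = ‖B u.1‖
    rw [norm_smul, norm_state_of_extendsSquare hB hL hc _ u.2, norm_inv, Complex.norm_real,
      Real.norm_of_nonneg (Real.sqrt_nonneg 2), inv_mul_cancel_left₀ (by positivity)]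
  have hp : DenseRange p := hB.denseRange_square
  -- Equality of the norms of `p u` and `q u` makes `p u ↦ q u` well defined, and density of the
  -- range of `p` extends it to all of `F`.
  have hext : ∀ u, q.extendOfNorm p (p u) = q u := fun u =>
    LinearMap.extendOfNorm_eq hp ⟨1, fun u => by rw [one_mul, hq]⟩ u
  have hnorm : ∀ f, ‖q.extendOfNorm p f‖ = ‖f‖ := by
    refine congrFun (hp.equalizer (by fun_prop) (by fun_prop) (funext fun u => ?_))
    change ‖q.extendOfNorm p (p u)‖ = _
    rw [hext, hq]
    rfl
  refine ⟨⟨(q.extendOfNorm p : F →ₗ[ℂ] EnergySpace L), hnorm⟩, fun u hu hjL => ?_⟩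
  have h1 : (q.extendOfNorm p) (B u) = ((Real.sqrt 2 : ℝ) : ℂ)⁻¹ •
      state L ⟨j u, hjL⟩ (c • j (B u)) := hext ⟨u, hu⟩
  change _ = ((Real.sqrt 2 : ℝ) : ℂ) • (q.extendOfNorm p) (B u)
  rw [h1, smul_inv_smul₀ hs]

theorem topologicalClosure_eq_range {H ι : Type*} [NormedAddCommGroup H] [InnerProductSpace ℂ H]
    {S : Submodule ℂ H} {J : F →ₗᵢ[ℂ] H} {p : ι → F} (hp : DenseRange p)
    {a : ℂ} (ha : a ≠ 0) (h₁ : ∀ i, a • J (p i) ∈ S) (h₂ : ∀ x ∈ S, ∃ f, x = a • J f) :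
    S.topologicalClosure = J.toLinearMap.range := by
  apply le_antisymm
  · refine Submodule.topologicalClosure_minimal _ (fun x hx => ?_)
      J.isometry.isClosedEmbedding.isClosed_range
    obtain ⟨f, rfl⟩ := h₂ x hx
    exact Submodule.smul_mem _ _ ⟨f, rfl⟩
  · rintro _ ⟨f, rfl⟩
    refine map_mem_closure J.continuous (hp f) ?_
    rintro _ ⟨i, rfl⟩
    have := S.smul_mem a⁻¹ (h₁ i)
    rwa [inv_smul_smul₀ ha] at this

theorem topologicalClosure_squareGraph (hB : IsSimpleMaximalSymmetric B)
    (hL : ExtendsSquare L j B) {c : ℂ} {J : F →ₗᵢ[ℂ] EnergySpace L}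
    (hJ : ∀ (u : B.domain) (_ : B u ∈ B.domain) (hjL : j u ∈ L.op.domain),
      state L ⟨j u, hjL⟩ (c • j (B u)) = ((Real.sqrt 2 : ℝ) : ℂ) • J (B u)) :
    (squareGraph L j B c).topologicalClosure = J.toLinearMap.range := by
  refine topologicalClosure_eq_range (a := ((Real.sqrt 2 : ℝ) : ℂ)) hB.denseRange_square
    (by rw [Complex.ofReal_ne_zero]; positivity) (fun u => ?_) ?_
  · exact ⟨u.1, u.2, (hL u.1 u.2).1, (hJ _ u.2 _).symm⟩
  · rintro _ ⟨u, hu, hjL, rfl⟩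
    exact ⟨B u, hJ u hu hjL⟩

/-- Since `V` commutes with `B`, `D(B_V²) = V D(B²)` and `B_V V w = V B w = B V w`. The generating
vectors are thus `[V w; c B V w] = √2 J (V B w)`. -/
theorem topologicalClosure_squareGraph_transported (hB : IsSimpleMaximalSymmetric B)
    (hL : ExtendsSquare L j B) {V : F →ₗᵢ[ℂ] F} (hV : CommutesWith V B) {c : ℂ}
    {J : F →ₗᵢ[ℂ] EnergySpace L}
    (hJ : ∀ (u : B.domain) (_ : B u ∈ B.domain) (hjL : j u ∈ L.op.domain),
      state L ⟨j u, hjL⟩ (c • j (B u)) = ((Real.sqrt 2 : ℝ) : ℂ) • J (B u)) :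
    (squareGraph L (j.comp V.toLinearMap.range.subtypeₗᵢ) (transported V B) c).topologicalClosure =
      (J.comp V).toLinearMap.range := by
  have hVB : ∀ w : B.domain, B w ∈ B.domain → ∃ (h : V w ∈ B.domain) (_ : B ⟨V w, h⟩ ∈ B.domain),
      B ⟨V w, h⟩ = V (B w) := by
    intro w hw
    obtain ⟨h, hVw⟩ := hV w
    exact ⟨h, hVw ▸ (hV ⟨B w, hw⟩).1, hVw⟩
  refine topologicalClosure_eq_range (a := ((Real.sqrt 2 : ℝ) : ℂ)) hB.denseRange_square
    (by rw [Complex.ofReal_ne_zero]; positivity) (fun w => ?_) ?_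
  · obtain ⟨h, h', hVw⟩ := hVB w.1 w.2
    have hs : ∀ f : F, V.equivRange.symm ⟨V f, ⟨f, rfl⟩⟩ = f := fun f =>
      V.equivRange.symm_apply_apply f
    have hd : (⟨V w.1, ⟨w.1, rfl⟩⟩ : V.toLinearMap.range) ∈ (transported V B).domain := by
      change V.equivRange.symm _ ∈ B.domain
      rw [hs]
      exact w.1.2
    have hval : transported V B ⟨_, hd⟩ = ⟨V (B w.1), ⟨B w.1, rfl⟩⟩ := by
      change V.equivRange (B ⟨V.equivRange.symm ⟨V w.1, ⟨w.1, rfl⟩⟩, hd⟩) = _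
      have : (⟨V.equivRange.symm ⟨V w.1, ⟨w.1, rfl⟩⟩, hd⟩ : B.domain) = w.1 := Subtype.ext (hs _)
      rw [this]
      rfl
    refine ⟨⟨_, hd⟩, ?_, (hL ⟨V w.1, h⟩ h').1, ?_⟩
    · rw [hval]
      change V.equivRange.symm _ ∈ B.domain
      rw [hs]
      exact w.2
    · rw [hval]
      have := hJ ⟨V w.1, h⟩ h' (hL ⟨V w.1, h⟩ h').1
      rw [hVw] at this
      exact this.symm
  · rintro _ ⟨x, hx, hjL, rfl⟩
    obtain ⟨⟨_, ⟨w, rfl⟩⟩, hd⟩ := x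
    have hs : V.equivRange.symm ⟨V w, ⟨w, rfl⟩⟩ = w := V.equivRange.symm_apply_apply w
    have hw : w ∈ B.domain := by
      have : V.equivRange.symm ⟨V w, ⟨w, rfl⟩⟩ ∈ B.domain := hd
      rwa [hs] at this
    have hval : transported V B ⟨_, hd⟩ = V.equivRange (B ⟨w, hw⟩) := by
      change V.equivRange (B ⟨V.equivRange.symm ⟨V w, ⟨w, rfl⟩⟩, hd⟩) = _
      have : (⟨V.equivRange.symm ⟨V w, ⟨w, rfl⟩⟩, hd⟩ : B.domain) = ⟨w, hw⟩ := Subtype.ext hs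
      rw [this]
    have hBw : B ⟨w, hw⟩ ∈ B.domain := by
      rw [hval] at hx
      have : V.equivRange.symm (V.equivRange (B ⟨w, hw⟩)) ∈ B.domain := hx
      rwa [LinearIsometryEquiv.symm_apply_apply] at this
    obtain ⟨h, h', hVw⟩ := hVB ⟨w, hw⟩ hBw
    refine ⟨B ⟨w, hw⟩, ?_⟩
    rw [hval]
    have := hJ ⟨V w, h⟩ h' hjL
    rw [hVw] at this
    exact this

omit [CompleteSpace F] in
-- The generator sends `[u; cBu]` to `[cBu; -B²u] = c [Bu; cB²u]` because `c² = -1`. Both vectors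
-- must come from `D(B²)`, hence the condition `u ∈ D(B³)`.
theorem energy_isometry_mem_generatorGraph {W : ℝ → EnergySpace L ≃ₗᵢ[ℂ] EnergySpace L}
    (hW : IsWaveGroup L W) (hL : ExtendsSquare L j B) {c : ℂ} (hc : c * c = -1)
    {J : F →ₗᵢ[ℂ] EnergySpace L}
    (hJ : ∀ (u : B.domain) (_ : B u ∈ B.domain) (hjL : j u ∈ L.op.domain),
      state L ⟨j u, hjL⟩ (c • j (B u)) = ((Real.sqrt 2 : ℝ) : ℂ) • J (B u))
    (u : B.domain) (hu : B u ∈ B.domain) (huu : B ⟨B u, hu⟩ ∈ B.domain) :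
    (J (B u), J (c • B ⟨B u, hu⟩)) ∈ generatorGraph W := by
  obtain ⟨h₁, hL₁⟩ := hL u hu
  obtain ⟨h₂, hL₂⟩ := hL ⟨B u, hu⟩ huu
  have hs : ((Real.sqrt 2 : ℝ) : ℂ) ≠ 0 := by
    rw [Complex.ofReal_ne_zero]; positivity
  have hmem : (state L ⟨j u, h₁⟩ (c • j (B u)),
      c • state L ⟨j (B u), h₂⟩ (c • j (B ⟨B u, hu⟩))) ∈ generatorGraph W := by
    refine (hW.generator _ _).2 (subset_closure ⟨⟨j u, h₁⟩, c • ⟨j (B u), h₂⟩, ?_⟩)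
    rw [← state_smul, smul_smul, hc, hL₁, neg_one_smul]
    rfl
  have := (generatorGraph W).smul_mem ((Real.sqrt 2 : ℝ) : ℂ)⁻¹ hmem
  rw [hJ u hu h₁, hJ ⟨B u, hu⟩ huu h₂, smul_comm c, Prod.smul_mk, inv_smul_smul₀ hs,
    inv_smul_smul₀ hs] at this
  rwa [map_smul]

theorem cogenerator_energy_isometry (hB : IsSimpleMaximalSymmetric B)
    {J : F →ₗᵢ[ℂ] EnergySpace L} {U : EnergySpace L ≃ₗᵢ[ℂ] EnergySpace L}
    (hU : ∀ (u : B.domain) (hu : B u ∈ B.domain), B ⟨B u, hu⟩ ∈ B.domain →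
      U (J (shiftBy B I ⟨B u, hu⟩)) = J (shiftBy B (-I) ⟨B u, hu⟩)) (f : F) :
    U (J f) = J (cayley B hB f) := by
  have hcont : Continuous (cayley B hB) :=
    AddMonoidHomClass.continuous_of_bound (cayley B hB) 1 fun f => by rw [norm_cayley, one_mul]
  refine congrFun (hB.denseRange_square.equalizer (U.continuous.comp J.continuous)
    (J.continuous.comp hcont) (funext fun z => ?_)) f
  change U (J (B z.1)) = J (cayley B hB (B z.1))
  -- For `z ∈ D(B²)`, the solution of `(B + i) u = z` lies in `D(B³)` and `(B + i) B u = B z`; so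
  -- the identity holds on the dense set of vectors `B z`.
  obtain ⟨u, hu⟩ := (shiftBy_bijective hB).2 (z.1 : F)
  have hu' : B u = z.1 - I • (u : F) := eq_sub_of_add_eq hu
  have hBu : B u ∈ B.domain := by
    rw [hu']
    exact sub_mem z.1.2 (Submodule.smul_mem _ _ u.2)
  have hBu' : (⟨B u, hBu⟩ : B.domain) = z.1 - I • u := Subtype.ext hu'
  have hBBu : B ⟨B u, hBu⟩ = B z.1 - I • B u := by
    rw [hBu', LinearPMap.map_sub, LinearPMap.map_smul]
  have hshift : shiftBy B I ⟨B u, hBu⟩ = B z.1 := by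
    change B ⟨B u, hBu⟩ + I • B u = _
    rw [hBBu, sub_add_cancel]
  have hmem : B ⟨B u, hBu⟩ ∈ B.domain := by
    rw [hBBu]
    exact sub_mem z.2 (Submodule.smul_mem _ _ hBu)
  have := hU u hBu hmem
  rw [hshift, ← cayley_shiftBy hB, hshift] at this
  exact this

theorem asymptoticallyEquivalent_squareGraph_iff {W : ℝ → EnergySpace L ≃ₗᵢ[ℂ] EnergySpace L}
    (hW : IsWaveGroup L W) (hB : IsSimpleMaximalSymmetric B) (hL : ExtendsSquare L j B)
    {V : F →ₗᵢ[ℂ] F} (hV : CommutesWith V B) {c : ℂ} (hc : c = I ∨ c = -I) :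
    AsymptoticallyEquivalent W (squareGraph L j B c).topologicalClosure
        (squareGraph L (j.comp V.toLinearMap.range.subtypeₗᵢ)
          (transported V B) c).topologicalClosure ↔
      ∀ γ ∈ kerAdjoint V,
        Tendsto (fun n : ℕ => ‖(compressedCayley B hB V ^ n) γ‖) atTop (𝓝 0) := by
  have hcc : c * c = -1 := by rcases hc with rfl | rfl <;> simp
  have hG := hW.isUnitaryGroup
  obtain ⟨J, hJ⟩ := exists_energy_isometry hB hL hcc
  obtain ⟨C, hC⟩ := hG.exists_cogenerator
  rw [topologicalClosure_squareGraph hB hL hJ,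
    topologicalClosure_squareGraph_transported hB hL hV hJ]
  have hinv : ∀ M : Submodule ℂ (EnergySpace L), IsClosed (M : Set (EnergySpace L)) →
      ((∀ t, ∀ x ∈ M, W t x ∈ M) ↔ (∀ x ∈ M, C x ∈ M) ∧ ∀ x ∈ M, C.symm x ∈ M) := by
    intro M hM
    have : CompleteSpace M := hM.completeSpace_coe
    exact ⟨fun h => hG.cogenerator_mem hC h,
      fun h t x hx => hG.apply_mem_of_cogenerator hC h.1 h.2 t hx⟩
  rcases hc with rfl | rfl
  · refine asymptoticallyEquivalent_range_iff hG hinv (J := J) (T := cayley B hB)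
      (cogenerator_energy_isometry hB fun u hu huu => ?_) (cayley_comm hB hV)
    have h := hC _ _ (energy_isometry_mem_generatorGraph hW hL hcc hJ u hu huu)
    -- With `A = iB`: `A - 1 = i(B + i)` and `A + 1 = i(B - i)`, so `C` acts as `T`.
    have h₁ : I • B ⟨B u, hu⟩ - B u = I • shiftBy B I ⟨B u, hu⟩ := by
      change _ = I • (B ⟨B u, hu⟩ + I • B u)
      rw [smul_add, smul_smul, I_mul_I, neg_one_smul, sub_eq_add_neg]
    have h₂ : I • B ⟨B u, hu⟩ + B u = I • shiftBy B (-I) ⟨B u, hu⟩ := by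
      change _ = I • (B ⟨B u, hu⟩ + (-I) • B u)
      rw [smul_add, smul_smul, mul_neg, I_mul_I, neg_neg, one_smul]
    rw [← map_sub, ← _root_.map_add, h₁, h₂, map_smul, map_smul, map_smul] at h
    exact smul_right_injective _ I_ne_zero h
  -- With `A = -iB`: `A - 1 = -i(B - i)` and `A + 1 = -i(B + i)`, so it is the inverse of `C` that
  -- acts as `T`.
  · refine asymptoticallyEquivalent_range_iff hG (U := C.symm)
      (fun M hM => (hinv M hM).trans and_comm) (J := J) (T := cayley B hB)
      (cogenerator_energy_isometry hB fun u hu huu => ?_) (cayley_comm hB hV)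
    have h := hC _ _ (energy_isometry_mem_generatorGraph hW hL hcc hJ u hu huu)
    have h₁ : (-I) • B ⟨B u, hu⟩ - B u = (-I) • shiftBy B (-I) ⟨B u, hu⟩ := by
      change _ = (-I) • (B ⟨B u, hu⟩ + (-I) • B u)
      rw [smul_add, smul_smul, neg_mul_neg, I_mul_I, neg_one_smul, sub_eq_add_neg]
    have h₂ : (-I) • B ⟨B u, hu⟩ + B u = (-I) • shiftBy B I ⟨B u, hu⟩ := by
      change _ = (-I) • (B ⟨B u, hu⟩ + I • B u)
      rw [smul_add, smul_smul, neg_mul, I_mul_I, neg_neg, one_smul]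
    rw [← map_sub, ← _root_.map_add, h₁, h₂, map_smul, map_smul, map_smul] at h
    rw [LinearIsometryEquiv.symm_apply_eq]
    exact (smul_right_injective _ (neg_ne_zero.2 I_ne_zero) h).symm

end Energy

end AbstractWave

theorem corollary2p4 {E : Type*} [NormedAddCommGroup E] [InnerProductSpace ℂ E] [CompleteSpace E]
    (L : AbstractWave.PositiveSelfAdjoint E)
    (W : ℝ → AbstractWave.EnergySpace L ≃ₗᵢ[ℂ] AbstractWave.EnergySpace L)
    (hW : AbstractWave.IsWaveGroup L W)
    (K : Submodule ℂ E) [CompleteSpace K]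
    (B : K →ₗ.[ℂ] K) (hB : AbstractWave.IsSimpleMaximalSymmetric B)
    (hL : AbstractWave.ExtendsSquare L K.subtypeₗᵢ B)
    (V : K →ₗᵢ[ℂ] K) (hV : AbstractWave.CommutesWith V B) :
    (AbstractWave.AsymptoticallyEquivalent W
        (AbstractWave.outgoing L K.subtypeₗᵢ B)
        (AbstractWave.outgoing L (K.subtypeₗᵢ.comp V.toLinearMap.range.subtypeₗᵢ)
          (AbstractWave.transported V B)) ↔
      ∀ γ ∈ AbstractWave.kerAdjoint V,
        Tendsto (fun n : ℕ => ‖(AbstractWave.compressedCayley B hB V ^ n) γ‖) atTop (𝓝 0)) ∧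
    (AbstractWave.AsymptoticallyEquivalent W
        (AbstractWave.incoming L K.subtypeₗᵢ B)
        (AbstractWave.incoming L (K.subtypeₗᵢ.comp V.toLinearMap.range.subtypeₗᵢ)
          (AbstractWave.transported V B)) ↔
      ∀ γ ∈ AbstractWave.kerAdjoint V,
        Tendsto (fun n : ℕ => ‖(AbstractWave.compressedCayley B hB V ^ n) γ‖) atTop (𝓝 0)) :=
  ⟨AbstractWave.asymptoticallyEquivalent_squareGraph_iff hW hB hL hV (Or.inl rfl),
    AbstractWave.asymptoticallyEquivalent_squareGraph_iff hW hB hL hV (Or.inr rfl)⟩
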